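/- Let $H\neq\{0\}$ be a complex Hilbert space and let $(K,[\cdot,\cdot])$ be a Pontryagin space of (negative) index $\tilde\kappa$. For a bounded operator $\Gamma:H\to K$ let $\Gamma^{+}:K\to H$ be defined by $(h,\Gamma^{+}k)=[\Gamma h,k]$. Let $A$ be a bounded operator in $K$ that is self-adjoint with respect to $[\cdot,\cdot]$, and let $\Gamma_0:H\to K$ be a bounded operator such that $\Gamma_0^{+}\Gamma_0$ is boundedly invertible. Let $Q$, with domain $D(Q)\subseteq\rho(A)$, be a generalized Nevanlinna function of class $N_\kappa(H)$ with $$Q(z)=\Gamma_0^{+}(A-z)^{-1}\Gamma_0,\qquad z\in D(Q)$$ (this representation need not be minimal). Here $Q\in N_\kappa(H)$ means: $Q$ is meromorphic in $\mathbb C\setminus\mathbb R$; it is holomorphic at the nonreal points of $D(Q)$, which are all of $\mathbb C\setminus\mathbb R$ up to a discrete set; $D(Q)$ is symmetric with respect to $\mathbb R$ and $Q(\bar z)^*=Q(z)$; and the kernel $N_Q(z,w)=\frac{Q(z)-Q(w)^*}{z-\bar w}$ on $D(Q)\cap\mathbb C^{+}$ has $\kappa$ negative squares, i.e. the Hermitian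 matrices $\bigl((N_Q(z_i,z_j)h_i,h_j)\bigr)_{i,j=1}^n$ with $z_i\in D(Q)\cap\mathbb C^+$, $h_i\in H$ have at most $\kappa$ negative eigenvalues, and at least one of them has exactly $\kappa$. Put $P:=\Gamma_0(\Gamma_0^{+}\Gamma_0)^{-1}\Gamma_0^{+}$, $D(\hat Q):=\{z\in D(Q): Q(z)\text{ is boundedly invertible}\}$ and $\hat Q(z):=-Q(z)^{-1}$ for $z\in D(\hat Q)$. Then $\tilde\kappa\ge\kappa$, $D(\hat Q)\cap\mathbb C^{+}\neq\emptyset$, and there is a self-adjoint linear relation $\hat A\subseteq K\times K$ such that: (a) for every $z_0\in D(\hat Q)\cap\mathbb C^{+}$, with $\hat\Gamma:=-(A-z_0)^{-1}\Gamma_0\,Q(z_0)^{-1}$, one has $\{z_0\}\cup D(\hat Q)\subseteq\rho(\hat A)$, and for all $z\in D(\hat Q)$ $$\hat Q(z)=-Q(\bar z_0)^{-1}+(z-\bar z_0)\,\hat\Gamma^{+}\bigl(I+(z-z_0)(\hat A-z)^{-1}\bigr)\hat\Gamma ,$$ where $-Q(\bar z_0)^{-1}=\hat Q(z_0)^{*}$,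 so that this is a representation of $\hat Q$ of the form $\hat Q(z)=\hat Q(z_0)^{*}+(z-\bar z_0)\hat\Gamma^{+}(I+(z-z_0)(\hat A-z)^{-1})\hat\Gamma$; (b) the multivalued part $\hat A(0)=\{y:(0,y)\in\hat A\}$ satisfies $\hat A(0)=R(P)=R(\Gamma_0)$, where $R(\cdot)$ denotes the range. It is nonzero, i.e. $\infty$ is an eigenvalue of $\hat A$, and $\hat A$ is not (the graph of) an operator. -/

import Mathlib

open scoped ComplexConjugate

/-- A Pontryagin space of index `κ`: the complex Hilbert space `K` with a fundamental symmetry `J`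
whose negative eigenspace has dimension `κ < ∞`. The indefinite scalar product is
`[x, y] = (J x, y)`, and the Hilbert space topology of `K` is its topology. -/
structure PontryaginSpace (K : Type*) [NormedAddCommGroup K] [InnerProductSpace ℂ K]
    [CompleteSpace K] (κ : ℕ) where
  J : K →L[ℂ] K
  selfAdjoint : IsSelfAdjoint J
  involutive : J * J = 1
  finiteDimensional_neg : FiniteDimensional ℂ (LinearMap.ker ((J + 1 : K →L[ℂ] K) : K →ₗ[ℂ] K))
  finrank_neg : Module.finrank ℂ (LinearMap.ker ((J + 1 : K →L[ℂ] K) : K →ₗ[ℂ] K)) = κ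

namespace PontryaginSpace

variable {H : Type*} [NormedAddCommGroup H] [InnerProductSpace ℂ H] [CompleteSpace H]
  {K : Type*} [NormedAddCommGroup K] [InnerProductSpace ℂ K] [CompleteSpace K] {κ : ℕ}

/-- The indefinite scalar product `[x, y]`, linear in `x` and conjugate linear in `y`
(Mathlib's `inner` is conjugate linear in its first argument). -/
noncomputable def form (S : PontryaginSpace K κ) (x y : K) : ℂ := inner ℂ y (S.J x)

/-- The adjoint `Γ⁺ : K → H` of a bounded operator `Γ : H → K` from a Hilbert space,
`(h, Γ⁺ k) = [Γ h, k]`. -/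
noncomputable def adj (S : PontryaginSpace K κ) (Γ : H →L[ℂ] K) : K →L[ℂ] H :=
  (ContinuousLinearMap.adjoint Γ) ∘L S.J

theorem inner_adj (S : PontryaginSpace K κ) (Γ : H →L[ℂ] K) (h : H) (k : K) :
    inner ℂ (S.adj Γ k) h = S.form (Γ h) k := by
  have hJ : ContinuousLinearMap.adjoint S.J = S.J := S.selfAdjoint
  simp only [adj, form, ContinuousLinearMap.comp_apply]
  rw [ContinuousLinearMap.adjoint_inner_left]
  conv_lhs => rw [← hJ]
  rw [ContinuousLinearMap.adjoint_inner_left]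

/-- The bounded operator `A` is self-adjoint with respect to `[·, ·]`. -/
def IsSelfAdjointOp (S : PontryaginSpace K κ) (A : K →L[ℂ] K) : Prop :=
  ∀ x y : K, S.form (A x) y = S.form x (A y)

/-- The adjoint of a linear relation `R ⊆ K × K`:
`{(u, v) | [y, u] = [x, v] for all (x, y) ∈ R}`. -/
noncomputable def relAdjoint (S : PontryaginSpace K κ) (R : Submodule ℂ (K × K)) :
    Submodule ℂ (K × K) where
  carrier := {p | ∀ q ∈ R, S.form q.2 p.1 = S.form q.1 p.2}
  add_mem' := by
    intro a b ha hb q hq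
    have h1 := ha q hq
    have h2 := hb q hq
    simp only [form] at h1 h2
    simp only [form, Prod.fst_add, Prod.snd_add, inner_add_left, h1, h2]
  zero_mem' := by
    intro q _
    simp [form]
  smul_mem' := by
    intro c a ha q hq
    have h1 := ha q hq
    simp only [form] at h1
    simp only [form, Prod.smul_fst, Prod.smul_snd, inner_smul_left, h1]

/-- A linear relation is self-adjoint if it equals its adjoint. -/
def IsSelfAdjointRel (S : PontryaginSpace K κ) (R : Submodule ℂ (K × K)) : Prop :=
  S.relAdjoint R = R

/-- The operator `P = Γ₀ (Γ₀⁺ Γ₀)⁻¹ Γ₀⁺`. -/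
noncomputable def proj (S : PontryaginSpace K κ) (Γ₀ : H →L[ℂ] K) : K →L[ℂ] K :=
  Γ₀ ∘L Ring.inverse (S.adj Γ₀ ∘L Γ₀) ∘L S.adj Γ₀

end PontryaginSpace

namespace LinRel

variable {K : Type*} [NormedAddCommGroup K] [InnerProductSpace ℂ K]

/-- The linear relation `(R - z)⁻¹ = {(y - z x, x) | (x, y) ∈ R}`. -/
def shiftInv (R : Submodule ℂ (K × K)) (z : ℂ) : Submodule ℂ (K × K) :=
  R.comap ((LinearMap.snd ℂ K K).prod (LinearMap.fst ℂ K K + z • LinearMap.snd ℂ K K))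

theorem mem_shiftInv (R : Submodule ℂ (K × K)) (z : ℂ) (u x : K) :
    (u, x) ∈ shiftInv R z ↔ (x, u + z • x) ∈ R := by
  simp [shiftInv]

/-- The resolvent set: all `z` for which `(R - z)⁻¹` is a bounded operator defined on `K`. -/
def resolventSet (R : Submodule ℂ (K × K)) : Set ℂ :=
  {z | ∃ T : K →L[ℂ] K, LinearMap.graph (T : K →ₗ[ℂ] K) = shiftInv R z}

open Classical in
/-- The resolvent `(R - z)⁻¹` as a bounded operator, for `z` in the resolvent set. -/
noncomputable def resolvent (R : Submodule ℂ (K × K)) (z : ℂ) : K →L[ℂ] K :=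
  if h : z ∈ resolventSet R then Classical.choose h else 0

/-- The multivalued part `R(0) = {y | (0, y) ∈ R}`. -/
def multivaluedPart (R : Submodule ℂ (K × K)) : Submodule ℂ K :=
  R.comap (LinearMap.inr ℂ K K)

/-- `∞` is an eigenvalue of `R`, with eigenvector a nonzero element of `R(0)`. -/
def HasEigenvalueAtInfinity (R : Submodule ℂ (K × K)) : Prop :=
  ∃ y ∈ multivaluedPart R, y ≠ 0

/-- `R` is the graph of a (possibly not everywhere defined) linear operator. -/
def IsOperator (R : Submodule ℂ (K × K)) : Prop :=
  ∃ T : K →ₗ.[ℂ] K, T.graph = R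

end LinRel

namespace GenNevanlinna

variable {H : Type*} [NormedAddCommGroup H] [InnerProductSpace ℂ H] [CompleteSpace H]
  {K : Type*} [NormedAddCommGroup K] [InnerProductSpace ℂ K] [CompleteSpace K] {κ : ℕ}

/-- The Nevanlinna kernel `N_Q(z, w) = (Q(z) - Q(w)*) / (z - w̄)`. -/
noncomputable def kernel (Q : ℂ → H →L[ℂ] H) (z w : ℂ) : H →L[ℂ] H :=
  (z - conj w)⁻¹ • (Q z - ContinuousLinearMap.adjoint (Q w))

/-- The matrix `(N_Q(zᵢ, zⱼ) hᵢ, hⱼ)`. -/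
noncomputable def gram (Q : ℂ → H →L[ℂ] H) {n : ℕ} (z : Fin n → ℂ) (h : Fin n → H) :
    Matrix (Fin n) (Fin n) ℂ :=
  Matrix.of fun i j => inner ℂ (h j) (kernel Q (z i) (z j) (h i))

/-- The number of negative eigenvalues of a Hermitian matrix, with multiplicities. -/
noncomputable def negCount {n : ℕ} {M : Matrix (Fin n) (Fin n) ℂ} (hM : M.IsHermitian) : ℕ :=
  Nat.card {i : Fin n // hM.eigenvalues i < 0}

/-- `Q`, with domain `D`, is a generalized Nevanlinna function of index `κ`: it is meromorphic
in `ℂ \ ℝ` and holomorphic at the nonreal points of `D`, which are all of `ℂ \ ℝ` up to a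
discrete set; it is symmetric; and its Nevanlinna kernel has exactly `κ` negative squares. -/
structure IsGenNevanlinna (κ : ℕ) (D : Set ℂ) (Q : ℂ → H →L[ℂ] H) : Prop where
  meromorphic : MeromorphicOn Q {z : ℂ | z.im ≠ 0}
  codiscrete : D ∈ Filter.codiscreteWithin {z : ℂ | z.im ≠ 0}
  analytic : ∀ z ∈ D, z.im ≠ 0 → AnalyticAt ℂ Q z
  symmetric : ∀ z ∈ D, conj z ∈ D ∧ ContinuousLinearMap.adjoint (Q (conj z)) = Q z
  negSquares_le : ∀ (n : ℕ) (z : Fin n → ℂ) (h : Fin n → H),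
    (∀ i, z i ∈ D ∧ 0 < (z i).im) → ∀ hM : (gram Q z h).IsHermitian, negCount hM ≤ κ
  negSquares_eq : ∃ (n : ℕ) (z : Fin n → ℂ) (h : Fin n → H),
    (∀ i, z i ∈ D ∧ 0 < (z i).im) ∧ ∃ hM : (gram Q z h).IsHermitian, negCount hM = κ

/-- The function `F`, with domain `D`, is represented by the self-adjoint linear relation `R` in
the Pontryagin space, the bounded operator `Γ` and the point of reference `z₀ ∈ ρ(R) ∩ ℂ⁺`:
`F(z) = F(z₀)* + (z - z̄₀) Γ⁺ (I + (z - z₀) (R - z)⁻¹) Γ` for `z ∈ D`. -/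
structure IsRepresentedBy (S : PontryaginSpace K κ) (D : Set ℂ) (F : ℂ → H →L[ℂ] H)
    (R : Submodule ℂ (K × K)) (Γ : H →L[ℂ] K) (z₀ : ℂ) : Prop where
  selfAdjoint : S.IsSelfAdjointRel R
  im_pos : 0 < z₀.im
  mem_resolventSet : z₀ ∈ LinRel.resolventSet R
  domain_subset : D ⊆ LinRel.resolventSet R
  eq : ∀ z ∈ D, F z = ContinuousLinearMap.adjoint (F z₀) +
    (z - conj z₀) • (S.adj Γ ∘L (1 + (z - z₀) • LinRel.resolvent R z) ∘L Γ)

/-- The resolvent `(A - z)⁻¹` of a bounded operator. -/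
noncomputable def opResolvent (A : K →L[ℂ] K) (z : ℂ) : K →L[ℂ] K :=
  Ring.inverse (A - z • (1 : K →L[ℂ] K))

/-- The inverse function `Q̂(z) = -Q(z)⁻¹`. -/
noncomputable def hat (Q : ℂ → H →L[ℂ] H) (z : ℂ) : H →L[ℂ] H := -Ring.inverse (Q z)

/-- The domain of `Q̂`: the points of `D` where `Q` is boundedly invertible. -/
def hatDomain (D : Set ℂ) (Q : ℂ → H →L[ℂ] H) : Set ℂ := {z ∈ D | IsUnit (Q z)}

end GenNevanlinna

namespace ContinuousLinearMap

/-! The relation is `rangeExtension`: `A` restricted to `ker Γ₀⁺`, with `R(Γ₀)` adjoined as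
multivalued part. Invertibility of `Γ₀⁺Γ₀` makes `K` the `[·,·]`-orthogonal sum of `ker Γ₀⁺` and
`R(Γ₀)`, whence self-adjointness (`isSelfAdjointRel_rangeExtension`).

Put `R_z = (A - z)⁻¹`. Solving `u = A x + Γ₀ h - z x` under `Γ₀⁺ x = 0` forces `Q(z) h = Γ₀⁺ R_z u`,
so the new resolvent is `R_z - R_z Γ₀ Q(z)⁻¹ Γ₀⁺ R_z` (`graph_eq_shiftInv`). The representation of
`-Q⁻¹` then reduces to the resolvent identity (`isRepresentedBy_hat`).

The same identity turns the Nevanlinna kernel into a Gram matrix in `K` (`gram_eq_form`), which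
bounds its negative squares by the index of `K` (`negCount_le`). Finally `-z Q(z) → Γ₀⁺Γ₀` at
infinity, so `Q(z)` is invertible for large `z` in `D`. -/

theorem inverse_apply_self {E : Type*} [NormedAddCommGroup E] [NormedSpace ℂ E] {B : E →L[ℂ] E}
    (hB : IsUnit B) (x : E) : Ring.inverse B (B x) = x :=
  DFunLike.congr_fun (Ring.inverse_mul_cancel B hB) x

theorem apply_inverse_self {E : Type*} [NormedAddCommGroup E] [NormedSpace ℂ E] {B : E →L[ℂ] E}
    (hB : IsUnit B) (x : E) : B (Ring.inverse B x) = x :=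
  DFunLike.congr_fun (Ring.mul_inverse_cancel B hB) x

end ContinuousLinearMap

/-! ### Geometry of the indefinite form, the extended relation, negative squares -/

namespace PontryaginSpace

open ContinuousLinearMap

variable {H : Type*} [NormedAddCommGroup H] [InnerProductSpace ℂ H] [CompleteSpace H]
  {K : Type*} [NormedAddCommGroup K] [InnerProductSpace ℂ K] [CompleteSpace K] {κ : ℕ}

theorem adjoint_J (S : PontryaginSpace K κ) : adjoint S.J = S.J :=
  S.selfAdjoint

theorem J_J (S : PontryaginSpace K κ) (x : K) : S.J (S.J x) = x := by
  have h := DFunLike.congr_fun S.involutive x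
  simpa using h

theorem form_sub_left (S : PontryaginSpace K κ) (x y w : K) :
    S.form (x - y) w = S.form x w - S.form y w := by
  simp [form]

theorem form_sub_right (S : PontryaginSpace K κ) (x y w : K) :
    S.form w (x - y) = S.form w x - S.form w y := by
  simp [form]

theorem form_add_left (S : PontryaginSpace K κ) (x y w : K) :
    S.form (x + y) w = S.form x w + S.form y w := by
  simp [form]

theorem form_add_right (S : PontryaginSpace K κ) (x y w : K) :
    S.form w (x + y) = S.form w x + S.form w y := by
  simp [form]

theorem form_smul_left (S : PontryaginSpace K κ) (c : ℂ) (x w : K) :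
    S.form (c • x) w = c * S.form x w := by
  simp [form]

theorem form_smul_right (S : PontryaginSpace K κ) (c : ℂ) (x w : K) :
    S.form w (c • x) = starRingEnd ℂ c * S.form w x := by
  rw [form, inner_smul_left, form]

theorem form_sum_left (S : PontryaginSpace K κ) {ι : Type*} (s : Finset ι) (f : ι → K) (w : K) :
    S.form (∑ i ∈ s, f i) w = ∑ i ∈ s, S.form (f i) w := by
  simp [form]

theorem form_sum_right (S : PontryaginSpace K κ) {ι : Type*} (s : Finset ι) (f : ι → K) (w : K) :
    S.form w (∑ i ∈ s, f i) = ∑ i ∈ s, S.form w (f i) := by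
  simp [form]

theorem form_symm (S : PontryaginSpace K κ) (x y : K) :
    starRingEnd ℂ (S.form x y) = S.form y x := by
  simp only [form, inner_conj_symm]
  conv_lhs => rw [← S.adjoint_J, adjoint_inner_left]

theorem form_nondegenerate (S : PontryaginSpace K κ) {y : K} (h : ∀ x, S.form x y = 0) :
    y = 0 := by
  have h1 := h (S.J y)
  rwa [form, S.J_J, inner_self_eq_zero] at h1

theorem form_adj (S : PontryaginSpace K κ) (Γ : H →L[ℂ] K) (k : K) (h : H) :
    S.form k (Γ h) = inner ℂ h (S.adj Γ k) := by
  rw [← S.form_symm, ← S.inner_adj, inner_conj_symm]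

theorem form_eq_zero_of_adj_eq_zero (S : PontryaginSpace K κ) (Γ : H →L[ℂ] K) {k : K}
    (hk : S.adj Γ k = 0) (h : H) : S.form (Γ h) k = 0 := by
  rw [← S.inner_adj, hk, inner_zero_left]

theorem adj_eq_zero (S : PontryaginSpace K κ) (Γ : H →L[ℂ] K) {k : K}
    (hk : ∀ h, S.form (Γ h) k = 0) : S.adj Γ k = 0 := by
  have := hk (S.adj Γ k)
  rwa [← S.inner_adj, inner_self_eq_zero] at this

/-- If `Γ⁺ Γ` is invertible, then `Γ` is injective. -/
theorem injective_of_isUnit (S : PontryaginSpace K κ) {Γ : H →L[ℂ] K}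
    (hΓ : IsUnit (S.adj Γ ∘L Γ)) : Function.Injective Γ := by
  intro a b hab
  have h2 := inverse_apply_self hΓ a
  have h3 := inverse_apply_self hΓ b
  rw [comp_apply] at h2 h3
  rw [← h2, ← h3, hab]

theorem proj_apply_range (S : PontryaginSpace K κ) {Γ : H →L[ℂ] K}
    (hΓ : IsUnit (S.adj Γ ∘L Γ)) (h : H) : S.proj Γ (Γ h) = Γ h := by
  exact congrArg Γ (inverse_apply_self hΓ h)

theorem adj_proj (S : PontryaginSpace K κ) {Γ : H →L[ℂ] K}
    (hΓ : IsUnit (S.adj Γ ∘L Γ)) (k : K) : S.adj Γ (S.proj Γ k) = S.adj Γ k := by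
  exact apply_inverse_self hΓ (S.adj Γ k)

theorem range_proj (S : PontryaginSpace K κ) {Γ : H →L[ℂ] K} (hΓ : IsUnit (S.adj Γ ∘L Γ)) :
    LinearMap.range (S.proj Γ : K →ₗ[ℂ] K) = LinearMap.range (Γ : H →ₗ[ℂ] K) := by
  ext y
  constructor
  · rintro ⟨k, rfl⟩
    exact ⟨Ring.inverse (S.adj Γ ∘L Γ) (S.adj Γ k), rfl⟩
  · rintro ⟨h, rfl⟩
    exact ⟨Γ h, S.proj_apply_range hΓ h⟩

/-- The orthogonal companion of `ker Γ⁺` is the range of `Γ`. -/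
theorem exists_of_form_ker_eq_zero (S : PontryaginSpace K κ) {Γ : H →L[ℂ] K}
    (hΓ : IsUnit (S.adj Γ ∘L Γ)) {w : K} (hw : ∀ x, S.adj Γ x = 0 → S.form x w = 0) :
    ∃ h, Γ h = w := by
  obtain ⟨h, hh⟩ : ∃ h, Γ h = S.proj Γ w := ⟨_, rfl⟩
  have hker : S.adj Γ (w - S.proj Γ w) = 0 := by rw [map_sub, S.adj_proj hΓ, sub_self]
  refine ⟨h, ?_⟩
  rw [hh, eq_comm, ← sub_eq_zero]
  -- Split `y = (y - P y) + P y`: the first part lies in `ker Γ⁺`, hence is orthogonal to `w` and to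
  -- `P w`; the second lies in `R(Γ)`, hence is orthogonal to `w - P w`.
  refine S.form_nondegenerate fun y => ?_
  have h1 : S.form (y - S.proj Γ y) w = 0 :=
    hw _ (by rw [map_sub, S.adj_proj hΓ, sub_self])
  have h2 : S.form (S.proj Γ y) (w - S.proj Γ w) = 0 :=
    S.form_eq_zero_of_adj_eq_zero Γ hker _
  have h3 : S.form (y - S.proj Γ y) (S.proj Γ w) = 0 := by
    rw [← hh, S.form_adj, map_sub, S.adj_proj hΓ, sub_self, inner_zero_right]
  rw [form_sub_left] at h1 h3
  rw [form_sub_right] at h2 ⊢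
  linear_combination h1 + h2 - h3

/-- The relation `{(x, A x + Γ h) | Γ⁺ x = 0}`. -/
noncomputable def rangeExtension (S : PontryaginSpace K κ) (A : K →L[ℂ] K) (Γ : H →L[ℂ] K) :
    Submodule ℂ (K × K) where
  carrier := {p | S.adj Γ p.1 = 0 ∧ ∃ h, p.2 = A p.1 + Γ h}
  add_mem' := by
    rintro a b ⟨ha, h, hh⟩ ⟨hb, h', hh'⟩
    refine ⟨by simp [ha, hb], h + h', ?_⟩
    simp only [Prod.fst_add, Prod.snd_add, map_add, hh, hh']
    abel
  zero_mem' := ⟨by simp, 0, by simp⟩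
  smul_mem' := by
    rintro c a ⟨ha, h, hh⟩
    refine ⟨by simp [ha], c • h, ?_⟩
    simp [hh]

theorem mem_rangeExtension (S : PontryaginSpace K κ) (A : K →L[ℂ] K) (Γ : H →L[ℂ] K) (x y : K) :
    (x, y) ∈ S.rangeExtension A Γ ↔ S.adj Γ x = 0 ∧ ∃ h, y = A x + Γ h :=
  Iff.rfl

/-- For `(u, v)` in the adjoint, testing against `(0, Γ h)` gives `Γ⁺ u = 0`; testing against `(x, A
x)` with `Γ⁺ x = 0` makes `v - A u` orthogonal to `ker Γ⁺`, hence an element of `R(Γ)`. -/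
theorem isSelfAdjointRel_rangeExtension (S : PontryaginSpace K κ) {A : K →L[ℂ] K}
    (hA : S.IsSelfAdjointOp A) {Γ : H →L[ℂ] K} (hΓ : IsUnit (S.adj Γ ∘L Γ)) :
    S.IsSelfAdjointRel (S.rangeExtension A Γ) := by
  ext ⟨u, v⟩
  rw [mem_rangeExtension]
  constructor
  · intro huv
    have huv' : ∀ x h, S.adj Γ x = 0 → S.form (A x + Γ h) u = S.form x v := fun x h hx =>
      huv (x, A x + Γ h) ⟨hx, h, rfl⟩
    refine ⟨S.adj_eq_zero Γ fun h => ?_, ?_⟩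
    · simpa [form] using huv' 0 h (map_zero _)
    · obtain ⟨h, hh⟩ := S.exists_of_form_ker_eq_zero hΓ (w := v - A u) fun x hx => by
        have := huv' x 0 hx
        rw [map_zero, add_zero] at this
        rw [form_sub_right, ← hA, this, sub_self]
      exact ⟨h, by rw [hh]; abel⟩
  · rintro ⟨hu, h, rfl⟩ ⟨x, y⟩ ⟨hx, h', hy⟩
    simp only at hx hy ⊢
    rw [hy, form_add_left, form_add_right, S.form_eq_zero_of_adj_eq_zero Γ hu, S.form_adj Γ, hx,
      inner_zero_right, hA]

theorem multivaluedPart_rangeExtension (S : PontryaginSpace K κ) (A : K →L[ℂ] K)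
    (Γ : H →L[ℂ] K) :
    LinRel.multivaluedPart (S.rangeExtension A Γ) = LinearMap.range (Γ : H →ₗ[ℂ] K) := by
  ext y
  change (0, y) ∈ S.rangeExtension A Γ ↔ _
  rw [mem_rangeExtension]
  simp [eq_comm]

/-- A family of vectors in a Pontryagin space of index `κ` has a Gram matrix with at most `κ`
negative eigenvalues. -/
theorem negCount_le (S : PontryaginSpace K κ) {n : ℕ} {M : Matrix (Fin n) (Fin n) ℂ}
    (hM : M.IsHermitian) (f : Fin n → K) (hf : ∀ i j, M i j = S.form (f i) (f j)) :
    GenNevanlinna.negCount hM ≤ κ := by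
  classical
  by_contra! hlt
  let ι := {i : Fin n // hM.eigenvalues i < 0}
  let v : Fin n → Fin n → ℂ := fun k => hM.eigenvectorBasis k
  -- The coordinates are conjugated because `M i j` is linear in `f i`; this makes `[g k, g l]`
  -- equal to `v k* M v l`.
  let g : ι → K := fun k => ∑ i, starRingEnd ℂ (v k i) • f i
  have hg : ∀ k l : ι, S.form (g k) (g l) = if k = l then (hM.eigenvalues k : ℂ) else 0 := by
    intro k l
    have h1 : S.form (g k) (g l) = star (v k) ⬝ᵥ M.mulVec (v l) := by
      simp only [g, form_sum_left, dotProduct, Matrix.mulVec, Finset.mul_sum]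
      refine Finset.sum_congr rfl fun i _ => ?_
      rw [form_sum_right]
      refine Finset.sum_congr rfl fun j _ => ?_
      rw [form_smul_left, form_smul_right, Complex.conj_conj, hf, Pi.star_apply, RCLike.star_def]
      ring
    have h2 : star (v k) ⬝ᵥ v l = if k = l then 1 else 0 := by
      have := orthonormal_iff_ite.mp hM.eigenvectorBasis.orthonormal k l
      rw [EuclideanSpace.inner_eq_star_dotProduct, dotProduct_comm] at this
      exact this.trans (if_congr Subtype.ext_iff.symm rfl rfl)
    rw [h1, show M.mulVec (v l) = hM.eigenvalues l • v l from hM.mulVec_eigenvectorBasis l,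
      dotProduct_smul, h2]
    split_ifs with h <;> simp [h]
  have := S.finiteDimensional_neg
  let N := LinearMap.ker ((S.J + 1 : K →L[ℂ] K) : K →ₗ[ℂ] K)
  -- `1 - J` is twice the projection onto the negative eigenspace. If there are more than `κ`
  -- vectors `g k`, some nontrivial combination is killed by it, so it is fixed by `J`: its form
  -- value is then nonnegative, yet negative by the diagonal Gram matrix.
  let p : K →ₗ[ℂ] N := LinearMap.codRestrict N ((1 - S.J : K →L[ℂ] K) : K →ₗ[ℂ] K) fun x => by
    simp [N, S.J_J]
  let φ : (ι → ℂ) →ₗ[ℂ] K := Fintype.linearCombination ℂ g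
  have hdim : Module.finrank ℂ N < Module.finrank ℂ (ι → ℂ) := by
    rw [show Module.finrank ℂ N = κ from S.finrank_neg, Module.finrank_fintype_fun_eq_card,
      ← Nat.card_eq_fintype_card]
    exact hlt
  obtain ⟨a, ha, ha0⟩ := (Submodule.ne_bot_iff _).mp
    (LinearMap.ker_ne_bot_of_finrank_lt (f := p ∘ₗ φ) hdim)
  have hJ : S.J (φ a) = φ a := by
    have : ((p (φ a) : N) : K) = 0 := by simpa using congrArg Subtype.val (LinearMap.mem_ker.mp ha)
    have h' : φ a - S.J (φ a) = 0 := this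
    exact (sub_eq_zero.mp h').symm
  have hpos : 0 ≤ (S.form (φ a) (φ a)).re := by
    rw [form, hJ]
    exact inner_self_nonneg (𝕜 := ℂ)
  have hval : (S.form (φ a) (φ a)).re = ∑ k : ι, hM.eigenvalues k * ‖a k‖ ^ 2 := by
    have : S.form (φ a) (φ a) = ((∑ k : ι, hM.eigenvalues k * ‖a k‖ ^ 2 : ℝ) : ℂ) := by
      simp only [φ, Fintype.linearCombination_apply, form_sum_left]
      push_cast
      refine Finset.sum_congr rfl fun k _ => ?_
      rw [form_sum_right, Finset.sum_eq_single k
        (fun l _ hl => by rw [form_smul_left, form_smul_right, hg, if_neg hl.symm]; simp) (by simp),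
        form_smul_left, form_smul_right, hg, if_pos rfl, ← Complex.mul_conj']
      ring
    rw [this, Complex.ofReal_re]
  obtain ⟨k, hk⟩ := Function.ne_iff.mp ha0
  have hneg : ∑ k : ι, hM.eigenvalues k * ‖a k‖ ^ 2 < 0 := by
    refine Finset.sum_neg' (fun l _ => ?_) ⟨k, Finset.mem_univ _, ?_⟩
    · exact mul_nonpos_of_nonpos_of_nonneg l.2.le (by positivity)
    · exact mul_neg_of_neg_of_pos k.2 (by have := norm_pos_iff.mpr hk; positivity)
  linarith

end PontryaginSpace

/-! ### Resolvents and multivalued parts of linear relations -/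

namespace LinRel

variable {K : Type*} [NormedAddCommGroup K] [InnerProductSpace ℂ K]

theorem resolvent_eq {R : Submodule ℂ (K × K)} {z : ℂ} {T : K →L[ℂ] K}
    (hT : LinearMap.graph (T : K →ₗ[ℂ] K) = shiftInv R z) : resolvent R z = T := by
  have h : ∃ T : K →L[ℂ] K, LinearMap.graph (T : K →ₗ[ℂ] K) = shiftInv R z := ⟨T, hT⟩
  rw [resolvent, dif_pos (show z ∈ resolventSet R from h)]
  have hgraph := (Classical.choose_spec h).trans hT.symm
  ext x
  exact hgraph.le (show (x, Classical.choose h x) ∈ _ from rfl)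

theorem not_isOperator_of_hasEigenvalueAtInfinity {R : Submodule ℂ (K × K)}
    (hR : HasEigenvalueAtInfinity R) : ¬ IsOperator R := by
  rintro ⟨T, rfl⟩
  obtain ⟨y, hy, hy0⟩ := hR
  exact hy0 (T.graph_fst_eq_zero_snd (x := (0 : K)) (x' := y) hy rfl)

end LinRel

/-! ### Resolvent calculus for `A` -/

namespace GenNevanlinna

open ContinuousLinearMap

variable {H : Type*} [NormedAddCommGroup H] [InnerProductSpace ℂ H] [CompleteSpace H]
  {K : Type*} [NormedAddCommGroup K] [InnerProductSpace ℂ K] [CompleteSpace K] {κ κ' : ℕ}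

omit [CompleteSpace K] in
theorem isUnit_sub_smul {A : K →L[ℂ] K} {z : ℂ} (hz : z ∈ resolventSet ℂ A) :
    IsUnit (A - z • (1 : K →L[ℂ] K)) := by
  have h : IsUnit (algebraMap ℂ (K →L[ℂ] K) z - A) := hz
  rw [Algebra.algebraMap_eq_smul_one] at h
  rw [← neg_sub]
  exact h.neg

omit [CompleteSpace K] in
theorem apply_opResolvent {A : K →L[ℂ] K} {z : ℂ} (hz : z ∈ resolventSet ℂ A) (x : K) :
    A (opResolvent A z x) = x + z • opResolvent A z x := by
  rw [← sub_eq_iff_eq_add]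
  exact apply_inverse_self (isUnit_sub_smul hz) x

omit [CompleteSpace K] in
theorem opResolvent_apply {A : K →L[ℂ] K} {z : ℂ} (hz : z ∈ resolventSet ℂ A) (x : K) :
    opResolvent A z (A x) = x + z • opResolvent A z x := by
  rw [← sub_eq_iff_eq_add, ← map_smul, ← map_sub]
  exact inverse_apply_self (isUnit_sub_smul hz) x

omit [CompleteSpace K] in
/-- The resolvent identity. -/
theorem opResolvent_sub {A : K →L[ℂ] K} {z w : ℂ} (hz : z ∈ resolventSet ℂ A)
    (hw : w ∈ resolventSet ℂ A) (x : K) :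
    (z - w) • opResolvent A z (opResolvent A w x) = opResolvent A z x - opResolvent A w x := by
  have h := opResolvent_apply hz (opResolvent A w x)
  rw [apply_opResolvent hw, map_add, map_smul] at h
  rw [sub_smul, sub_eq_sub_iff_add_eq_add, add_comm, ← h, add_comm]

theorem form_opResolvent (S : PontryaginSpace K κ) {A : K →L[ℂ] K} (hA : S.IsSelfAdjointOp A)
    {z : ℂ} (hz : z ∈ resolventSet ℂ A) (hz' : starRingEnd ℂ z ∈ resolventSet ℂ A) (x y : K) :
    S.form (opResolvent A z x) y = S.form x (opResolvent A (starRingEnd ℂ z) y) := by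
  have h1 := apply_opResolvent hz x
  have h2 := apply_opResolvent hz' y
  rw [← sub_eq_iff_eq_add] at h1 h2
  conv_lhs => rw [← h2]
  conv_rhs => rw [← h1]
  rw [S.form_sub_right, S.form_sub_left, S.form_smul_right, S.form_smul_left, Complex.conj_conj, hA]

theorem opResolvent_adj (S : PontryaginSpace K κ) {A : K →L[ℂ] K} (hA : S.IsSelfAdjointOp A)
    {z : ℂ} (hz : z ∈ resolventSet ℂ A) (hz' : starRingEnd ℂ z ∈ resolventSet ℂ A)
    (Γ : H →L[ℂ] K) (B : H →L[ℂ] H) :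
    S.adj (opResolvent A z ∘L Γ ∘L B) =
      adjoint B ∘L S.adj Γ ∘L opResolvent A (starRingEnd ℂ z) := by
  ext x
  refine ext_inner_right ℂ fun h => ?_
  rw [S.inner_adj]
  simp only [comp_apply]
  rw [form_opResolvent S hA hz hz', ← S.inner_adj, adjoint_inner_left]

theorem adjoint_inverse (B : H →L[ℂ] H) : adjoint (Ring.inverse B) = Ring.inverse (adjoint B) := by
  simpa [star_eq_adjoint] using (Ring.inverse_star B).symm

/-! ### Krein's formula, the index bound and the representation of `-Q⁻¹` -/

section Representation

variable {S : PontryaginSpace K κ'} {A : K →L[ℂ] K} {Γ : H →L[ℂ] K} {D : Set ℂ}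
  {Q : ℂ → H →L[ℂ] H}

/-- The Krein type formula for the resolvent of `{(x, A x + Γ h) | Γ⁺ x = 0}`. -/
theorem graph_eq_shiftInv {z : ℂ} (hz : z ∈ resolventSet ℂ A) {B : H →L[ℂ] H}
    (hB : B = S.adj Γ ∘L opResolvent A z ∘L Γ) (hu : IsUnit B) :
    LinearMap.graph ((opResolvent A z - opResolvent A z ∘L Γ ∘L Ring.inverse B ∘L S.adj Γ ∘L
      opResolvent A z : K →L[ℂ] K) : K →ₗ[ℂ] K) = LinRel.shiftInv (S.rangeExtension A Γ) z := by
  have hBa : ∀ h, B h = S.adj Γ (opResolvent A z (Γ h)) := fun h => by rw [hB]; rfl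
  have hBr : ∀ h, S.adj Γ (opResolvent A z (Γ (Ring.inverse B h))) = h := fun h =>
    (hBa _).symm.trans (apply_inverse_self hu h)
  have hBl : ∀ h, Ring.inverse B (S.adj Γ (opResolvent A z (Γ h))) = h := fun h => by
    rw [← hBa, inverse_apply_self hu]
  ext ⟨u, x⟩
  rw [LinRel.mem_shiftInv, PontryaginSpace.mem_rangeExtension, LinearMap.mem_graph_iff]
  simp only [coe_coe, sub_apply, comp_apply]
  constructor
  · rintro rfl
    refine ⟨by rw [map_sub, hBr, sub_self], Ring.inverse B (S.adj Γ (opResolvent A z u)), ?_⟩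
    rw [map_sub, apply_opResolvent hz, apply_opResolvent hz, smul_sub]
    abel
  · rintro ⟨hx, h, hh⟩
    -- Apply `(A - z)⁻¹` to `u + z x = A x + Γ h`; the condition `Γ⁺ x = 0` then determines `h`.
    have hx' : x = opResolvent A z u - opResolvent A z (Γ h) := by
      have := opResolvent_apply hz x
      rw [← sub_eq_iff_eq_add.mpr hh, map_sub, map_add, map_smul] at this
      rw [← sub_eq_zero] at this ⊢
      rw [← neg_eq_zero, ← this]
      abel
    have hh' : S.adj Γ (opResolvent A z u) = S.adj Γ (opResolvent A z (Γ h)) := by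
      rw [hx', map_sub, sub_eq_zero] at hx
      exact hx
    rw [hh', hBl, hx']

theorem adjoint_eq (hQ : IsGenNevanlinna κ D Q) {z : ℂ} (hz : z ∈ D) :
    adjoint (Q z) = Q (starRingEnd ℂ z) := by
  rw [← (hQ.symmetric z hz).2, adjoint_adjoint]

theorem adjoint_hat (hQ : IsGenNevanlinna κ D Q) {z : ℂ} (hz : z ∈ D) :
    adjoint (hat Q z) = -Ring.inverse (Q (starRingEnd ℂ z)) := by
  rw [hat, map_neg, adjoint_inverse, adjoint_eq hQ hz]

/-- The first resolvent identity for `Q`. -/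
theorem smul_adj_opResolvent (hD : D ⊆ resolventSet ℂ A)
    (hrep : ∀ z ∈ D, Q z = S.adj Γ ∘L opResolvent A z ∘L Γ) {z w : ℂ} (hz : z ∈ D) (hw : w ∈ D)
    (h : H) :
    (z - w) • S.adj Γ (opResolvent A z (opResolvent A w (Γ h))) = Q z h - Q w h := by
  rw [hrep z hz, hrep w hw, ← map_smul, opResolvent_sub (hD hz) (hD hw), map_sub]
  rfl

/-- The resolvent identity at `z` and `w̄` gives `N_Q(z, w) = Γ⁺ R_w̄ R_z Γ`, and `R_w̄` crosses the
form as `R_w`. -/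
theorem gram_eq_form (hA : S.IsSelfAdjointOp A) (hQ : IsGenNevanlinna κ D Q)
    (hD : D ⊆ resolventSet ℂ A) (hrep : ∀ z ∈ D, Q z = S.adj Γ ∘L opResolvent A z ∘L Γ) {n : ℕ}
    (z : Fin n → ℂ) (h : Fin n → H) (hz : ∀ i, z i ∈ D ∧ 0 < (z i).im) (i j : Fin n) :
    gram Q z h i j = S.form (opResolvent A (z i) (Γ (h i))) (opResolvent A (z j) (Γ (h j))) := by
  have hne : z i - starRingEnd ℂ (z j) ≠ 0 := fun h0 => by
    have := congrArg Complex.im h0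
    simp only [Complex.sub_im, Complex.conj_im, Complex.zero_im] at this
    linarith [(hz i).2, (hz j).2]
  have hj := (hQ.symmetric _ (hz j).1).1
  have hk : kernel Q (z i) (z j) (h i) =
      S.adj Γ (opResolvent A (starRingEnd ℂ (z j)) (opResolvent A (z i) (Γ (h i)))) := by
    rw [kernel, adjoint_eq hQ (hz j).1, smul_apply, sub_apply, inv_smul_eq_iff₀ hne,
      ← neg_sub (Q (starRingEnd ℂ (z j)) (h i)), ← smul_adj_opResolvent hD hrep hj (hz i).1,
      ← neg_smul, neg_sub]
  have hj' := form_opResolvent S hA (hD hj) (by simpa using hD (hz j).1)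
    (opResolvent A (z i) (Γ (h i))) (Γ (h j))
  rw [Complex.conj_conj] at hj'
  rw [← hj', S.form_adj, ← hk]
  rfl

theorem index_le (hA : S.IsSelfAdjointOp A) (hQ : IsGenNevanlinna κ D Q)
    (hD : D ⊆ resolventSet ℂ A) (hrep : ∀ z ∈ D, Q z = S.adj Γ ∘L opResolvent A z ∘L Γ) :
    κ ≤ κ' := by
  obtain ⟨n, z, h, hz, hM, rfl⟩ := hQ.negSquares_eq
  exact S.negCount_le hM _ (gram_eq_form hA hQ hD hrep z h hz)

/-- `-z Γ⁺ (A - z)⁻¹ Γ` tends to `Γ⁺ Γ` at infinity, so it is invertible for large `z`. -/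
theorem eventually_isUnit (hΓ : IsUnit (S.adj Γ ∘L Γ)) (A : K →L[ℂ] K) :
    ∀ᶠ z in Bornology.cobounded ℂ, IsUnit (S.adj Γ ∘L opResolvent A z ∘L Γ) := by
  -- With `w = 1/z`, `(A - z)⁻¹ = -w (1 - w A)⁻¹`; at `w = 0` the compression of `(1 - w A)⁻¹` is
  -- the unit `Γ⁺Γ`, and units form an open set.
  have hcont : ContinuousAt (fun w : ℂ => S.adj Γ ∘L Ring.inverse (1 - w • A) ∘L Γ) 0 := by
    have h1 : ContinuousAt (fun w : ℂ => Ring.inverse (1 - w • A)) 0 := by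
      refine ContinuousAt.comp (g := Ring.inverse) ?_ (by fun_prop)
      simpa using NormedRing.inverse_continuousAt (1 : (K →L[ℂ] K)ˣ)
    exact continuousAt_const.clm_comp (h1.clm_comp continuousAt_const)
  have h0 : ∀ᶠ w in nhds (0 : ℂ), IsUnit (S.adj Γ ∘L Ring.inverse (1 - w • A) ∘L Γ) := by
    refine hcont.eventually (Units.isOpen.mem_nhds ?_)
    change IsUnit (S.adj Γ ∘L Ring.inverse (1 - (0 : ℂ) • A) ∘L Γ)
    rw [zero_smul, sub_zero, Ring.inverse_one]
    exact hΓ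
  filter_upwards [Filter.tendsto_inv₀_cobounded.eventually h0,
    Bornology.eventually_ne_cobounded 0] with z hz hz0
  have h2 : opResolvent A z = (-z⁻¹) • Ring.inverse (1 - z⁻¹ • A) := by
    have h3 : A - z • (1 : K →L[ℂ] K) = (-z) • (1 - z⁻¹ • A) := by
      rw [smul_sub, smul_smul, neg_mul, mul_inv_cancel₀ hz0]
      simp [sub_eq_add_neg, add_comm]
    rw [opResolvent, h3]
    have hu : IsUnit (algebraMap ℂ (K →L[ℂ] K) (-z)) :=
      (isUnit_iff_ne_zero.mpr (neg_ne_zero.mpr hz0)).map _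
    have hinv : Ring.inverse (algebraMap ℂ (K →L[ℂ] K) (-z)) =
        algebraMap ℂ (K →L[ℂ] K) (-z)⁻¹ := by
      rw [← one_mul (Ring.inverse _), eq_comm, Ring.eq_mul_inverse_iff_mul_eq _ _ _ hu, ← map_mul,
        inv_mul_cancel₀ (neg_ne_zero.mpr hz0), map_one]
    rw [Algebra.smul_def, Ring.inverse_mul (Or.inl hu), hinv, ← Algebra.commutes,
      ← Algebra.smul_def, inv_neg]
  rw [h2, smul_comp, comp_smul]
  exact hz.smul (Units.mk0 (-z⁻¹) (by simpa using hz0))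

theorem exists_mem_hatDomain (hΓ : IsUnit (S.adj Γ ∘L Γ)) (hQ : IsGenNevanlinna κ D Q)
    (hrep : ∀ z ∈ D, Q z = S.adj Γ ∘L opResolvent A z ∘L Γ) :
    ∃ z ∈ hatDomain D Q, 0 < z.im := by
  obtain ⟨r, -, hr⟩ := (Filter.HasBasis.eventually_iff
    (Metric.hasBasis_cobounded_compl_closedBall (0 : ℂ))).mp (eventually_isUnit hΓ A)
  let x : ℂ := (|r| + 1 : ℝ) * Complex.I
  have hxim : 0 < x.im := by simp [x]; positivity
  have hxn : r < ‖x‖ := by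
    have : ‖x‖ = |r| + 1 := by
      simp [x, abs_of_pos (show 0 < |r| + 1 by positivity), -Complex.ofReal_add]
    rw [this]
    linarith [le_abs_self r]
  -- The point `x` itself may be missing from `D`, but a punctured neighbourhood of it is not.
  have h1 : D ∈ nhdsWithin x {x}ᶜ := by
    have := mem_codiscreteWithin.mp hQ.codiscrete x hxim.ne'
    rw [Filter.disjoint_principal_right] at this
    have hU : {z : ℂ | z.im ≠ 0} ∈ nhdsWithin x {x}ᶜ :=
      mem_nhdsWithin_of_mem_nhds
        ((isOpen_ne.preimage Complex.continuous_im).mem_nhds hxim.ne')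
    filter_upwards [this, hU] with y hy hyU
    by_contra hyD
    exact hy ⟨hyU, hyD⟩
  have h2 : ∀ᶠ z in nhdsWithin x {x}ᶜ, 0 < z.im ∧ r < ‖z‖ :=
    mem_nhdsWithin_of_mem_nhds <| ((isOpen_lt continuous_const Complex.continuous_im).inter
      (isOpen_lt continuous_const continuous_norm)).mem_nhds ⟨hxim, hxn⟩
  obtain ⟨z, hzD, hz1, hz2⟩ := (Filter.Eventually.and h1 h2).exists
  refine ⟨z, ⟨hzD, ?_⟩, hz1⟩
  rw [hrep z hzD]
  exact hr (by simpa using hz2)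

/-- With `Γ̂_z = -R_z Γ Q(z)⁻¹`, the factor `I + (z - z₀)(Â - z)⁻¹` carries `Γ̂_z₀` to `Γ̂_z`,
leaving only the product `Γ̂_z₀⁺ Γ̂_z` to evaluate. -/
theorem isRepresentedBy_hat (hA : S.IsSelfAdjointOp A) (hΓ : IsUnit (S.adj Γ ∘L Γ))
    (hQ : IsGenNevanlinna κ D Q) (hD : D ⊆ resolventSet ℂ A)
    (hrep : ∀ z ∈ D, Q z = S.adj Γ ∘L opResolvent A z ∘L Γ) {z₀ : ℂ} (hz₀ : z₀ ∈ hatDomain D Q)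
    (him : 0 < z₀.im) :
    IsRepresentedBy S (hatDomain D Q) (hat Q) (S.rangeExtension A Γ)
      (-(opResolvent A z₀ ∘L Γ ∘L Ring.inverse (Q z₀))) z₀ := by
  have hgraph : ∀ z ∈ hatDomain D Q, _ := fun z hz =>
    graph_eq_shiftInv (S := S) (hD hz.1) (hrep z hz.1) hz.2
  refine ⟨S.isSelfAdjointRel_rangeExtension hA hΓ, him, ⟨_, hgraph z₀ hz₀⟩,
    fun z hz => ⟨_, hgraph z hz⟩, fun z hz => ?_⟩
  have hc := (hQ.symmetric z₀ hz₀.1).1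
  have hcu : IsUnit (Q (starRingEnd ℂ z₀)) := by
    rw [← adjoint_eq hQ hz₀.1, ← star_eq_adjoint]
    exact hz₀.2.star
  have hadj : S.adj (-(opResolvent A z₀ ∘L Γ ∘L Ring.inverse (Q z₀))) =
      -(Ring.inverse (Q (starRingEnd ℂ z₀)) ∘L S.adj Γ ∘L opResolvent A (starRingEnd ℂ z₀)) := by
    rw [← adjoint_eq hQ hz₀.1, ← adjoint_inverse,
      ← opResolvent_adj S hA (hD hz₀.1) (hD hc)]
    simp [PontryaginSpace.adj]
  have hres : (1 + (z - z₀) • LinRel.resolvent (S.rangeExtension A Γ) z) ∘L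
      (-(opResolvent A z₀ ∘L Γ ∘L Ring.inverse (Q z₀))) =
        -(opResolvent A z ∘L Γ ∘L Ring.inverse (Q z)) := by
    rw [LinRel.resolvent_eq (hgraph z hz)]
    ext h
    -- Writing `h = Q(z₀) k` removes `Q(z₀)⁻¹`.
    obtain ⟨k, rfl⟩ : ∃ k, h = Q z₀ k := ⟨_, (apply_inverse_self hz₀.2 h).symm⟩
    have h1 := opResolvent_sub (hD hz.1) (hD hz₀.1) (Γ k)
    have h2 := smul_adj_opResolvent hD hrep hz.1 hz₀.1 k
    simp only [comp_apply, add_apply, smul_apply, sub_apply, neg_apply, one_apply_eq_self, map_neg,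
      inverse_apply_self hz₀.2]
    rw [smul_sub, ← map_smul (opResolvent A z), ← map_smul (opResolvent A z) _ (Γ _), ← map_smul Γ,
      ← map_smul (Ring.inverse _), h2, map_smul, h1]
    simp only [map_sub, inverse_apply_self hz.2]
    abel
  -- What remains is `Q(z̄₀)⁻¹ (Q(z) - Q(z̄₀)) Q(z)⁻¹ = Q(z̄₀)⁻¹ - Q(z)⁻¹`.
  rw [hres, hadj, adjoint_hat hQ hz₀.1, hat]
  ext h
  obtain ⟨k, rfl⟩ : ∃ k, h = Q z k := ⟨_, (apply_inverse_self hz.2 h).symm⟩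
  have h2 := smul_adj_opResolvent hD hrep hc hz.1 k
  rw [← neg_sub z, neg_smul, neg_eq_iff_eq_neg, neg_sub] at h2
  simp only [comp_apply, add_apply, smul_apply, neg_apply, map_neg, neg_neg, inverse_apply_self hz.2]
  rw [← map_smul, h2, map_sub, inverse_apply_self hcu]
  abel

end Representation

end GenNevanlinna

theorem corollary2
    {H : Type*} [NormedAddCommGroup H] [InnerProductSpace ℂ H] [CompleteSpace H] [Nontrivial H]
    {K : Type*} [NormedAddCommGroup K] [InnerProductSpace ℂ K] [CompleteSpace K]
    {κ κ' : ℕ} (S : PontryaginSpace K κ')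
    (A : K →L[ℂ] K) (hA : S.IsSelfAdjointOp A)
    (Γ₀ : H →L[ℂ] K) (hΓ₀ : IsUnit (S.adj Γ₀ ∘L Γ₀))
    (D : Set ℂ) (Q : ℂ → H →L[ℂ] H) (hQ : GenNevanlinna.IsGenNevanlinna κ D Q)
    (hD : D ⊆ resolventSet ℂ A)
    (hrep : ∀ z ∈ D, Q z = S.adj Γ₀ ∘L GenNevanlinna.opResolvent A z ∘L Γ₀) :
    κ ≤ κ' ∧
    (∃ z₀ ∈ GenNevanlinna.hatDomain D Q, 0 < z₀.im) ∧
    ∃ R : Submodule ℂ (K × K),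
      (∀ z₀ ∈ GenNevanlinna.hatDomain D Q, 0 < z₀.im →
        GenNevanlinna.IsRepresentedBy S (GenNevanlinna.hatDomain D Q) (GenNevanlinna.hat Q) R
          (-(GenNevanlinna.opResolvent A z₀ ∘L Γ₀ ∘L Ring.inverse (Q z₀))) z₀ ∧
        ContinuousLinearMap.adjoint (GenNevanlinna.hat Q z₀) =
          -Ring.inverse (Q (starRingEnd ℂ z₀))) ∧
      LinRel.multivaluedPart R = LinearMap.range (S.proj Γ₀ : K →ₗ[ℂ] K) ∧
      LinearMap.range (S.proj Γ₀ : K →ₗ[ℂ] K) = LinearMap.range (Γ₀ : H →ₗ[ℂ] K) ∧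
      LinRel.HasEigenvalueAtInfinity R ∧
      ¬ LinRel.IsOperator R := by
  have hker := S.multivaluedPart_rangeExtension A Γ₀
  have hinf : LinRel.HasEigenvalueAtInfinity (S.rangeExtension A Γ₀) := by
    obtain ⟨h, hh⟩ := exists_ne (0 : H)
    -- `Γ₀` is injective, so a nonzero `h` yields a nonzero vector of the multivalued part.
    refine ⟨Γ₀ h, hker ▸ ⟨h, rfl⟩, fun h0 => hh (S.injective_of_isUnit hΓ₀ ?_)⟩
    rw [h0, map_zero]
  exact ⟨GenNevanlinna.index_le hA hQ hD hrep,
    GenNevanlinna.exists_mem_hatDomain hΓ₀ hQ hrep, S.rangeExtension A Γ₀,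
    fun z₀ hz₀ him => ⟨GenNevanlinna.isRepresentedBy_hat hA hΓ₀ hQ hD hrep hz₀ him,
      GenNevanlinna.adjoint_hat hQ hz₀.1⟩,
    hker.trans (S.range_proj hΓ₀).symm, S.range_proj hΓ₀, hinf,
    LinRel.not_isOperator_of_hasEigenvalueAtInfinity hinf⟩
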